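/- **Theorem 1 (Error bounds for continuous functions).** Let $\Omega=[a,b]\times[c,d]$, let $a=x_0<\dots<x_m=b$ and $c=y_0<\dots<y_n=d$ be arbitrary partitions ($m,n\ge 1$), and let $\mathcal T_{mn}$ be the criss-cross triangulation of $\Omega$ obtained by drawing both diagonals in each subrectangle. Repeat boundary knots ($x_i=x_0$ for $i<0$, $x_i=x_m$ for $i>m$, and likewise for $y$) and set $h_i=x_i-x_{i-1}$, $k_j=y_j-y_{j-1}$, $s_i=\frac12(x_{i-1}+x_i)$, $t_j=\frac12(y_{j-1}+y_j)$, $M_{i,j}=(s_i,t_j)$, $A_{i,j}=(x_i,y_j)$, and for $1\le i\le m+1$, $1\le j\le n+1$ $$\sigma_i=\frac{h_i}{h_{i-1}+h_i},\quad \sigma_i'=1-\sigma_i,\quad \tau_j=\frac{k_j}{k_{j-1}+k_j},\quad \tau_j'=1-\tau_j .$$ For $0\le i\le m+1$, $0\le j\le n+1$ let $B_{ij}$ be the $C^1$ piecewise quadratic B-spline on $\mathcal T_{mn}$ with the following Bernstein–Bézier coefficients. Let $\beta_i(x_{i-1})=\sigma_i'$ (for $i\ge1$), $\beta_i(x_i)=\sigma_{i+1}$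 (for $i\le m$), $\beta_i=0$ at the other knots, and define $\bar\beta_j$ in the same way from $\tau',\tau$. The coefficient of $B_{ij}$ at a vertex $(x_p,y_q)$ is $\beta_i(x_p)\bar\beta_j(y_q)$; at the midpoint of the edge $[x_{r-1},x_r]\times\{y_q\}$ it is $\bar\beta_j(y_q)$ if $r=i$ and $0$ otherwise; at the midpoint of $\{x_p\}\times[y_{s-1},y_s]$ it is $\beta_i(x_p)$ if $s=j$ and $0$ otherwise; in each subrectangle, halfway between the centre and a corner it is the mean of the coefficients at the midpoints of the two sides meeting at that corner, and at the centre the mean of those at the midpoints of the four sides. For $f\in C(\Omega)$ put $$S_2f=\sum_{i=0}^{m+1}\sum_{j=0}^{n+1}\mu_{ij}(f)B_{ij},\qquad W_2^*f=\sum_{i=0}^{m+1}\sum_{j=0}^{n+1}\mu^*_{ij}(f)B_{ij},$$ $$\mu_{ij}(f)=b_{ij}f(M_{i,j})+a_if(M_{i-1,j})+c_if(M_{i+1,j})+\bar a_jf(M_{i,j-1})+\bar c_jf(M_{i,j+1}),$$ $$\mu^*_{ij}(f)=2f(M_{i,j})-\tfrac14\big[f(A_{i-1,j-1})+f(A_{i-1,j})+f(A_{i,j-1})+f(A_{i,j})\big],$$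 where, for $1\le i\le m$ and $1\le j\le n$, $$a_i=-\frac{\sigma_i^2\sigma_{i+1}'}{\sigma_i+\sigma_{i+1}'},\quad c_i=-\frac{\sigma_i(\sigma_{i+1}')^2}{\sigma_i+\sigma_{i+1}'},\quad \bar a_j=-\frac{\tau_j^2\tau_{j+1}'}{\tau_j+\tau_{j+1}'},\quad \bar c_j=-\frac{\tau_j(\tau_{j+1}')^2}{\tau_j+\tau_{j+1}'},$$ $a_0=c_0=a_{m+1}=c_{m+1}=\bar a_0=\bar c_0=\bar a_{n+1}=\bar c_{n+1}=0$, and $b_{ij}=1-(a_i+c_i+\bar a_j+\bar c_j)$. Let $h=\max\{h_i,k_j\}$, let $\|\cdot\|_\Omega$ be the supremum norm over $\Omega$, and $\omega(f,t)=\max\{|f(M)-f(P)|: M,P\in\Omega,\ \|M-P\|\le t\}$ with the Euclidean norm. Then for each of $Q=S_2$ and $Q=W_2^*$ there is a constant $C_0>0$, independent of $\Omega$, of the partitions and of $f$, with $C_0\le 20.5$ for $Q=S_2$ and $C_0\le 12$ for $Q=W_2^*$, such that for every $f\in C(\Omega)$ $$\|f-Qf\|_\Omega\le C_0\,\omega\!\left(f,\tfrac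 h2\right).$$ -/

import Mathlib

/-- A partition `a = x_0 < x_1 < ⋯ < x_m = b` of the segment `[a, b]` into `m ≥ 1` subintervals
(`size` is `m`; values of `knot` beyond index `m` are never used). -/
structure KnotPartition (a b : ℝ) where
  size : ℕ
  size_pos : 1 ≤ size
  knot : ℕ → ℝ
  knot_zero : knot 0 = a
  knot_size : knot size = b
  knot_lt : ∀ i < size, knot i < knot (i + 1)

namespace KnotPartition

variable {a b : ℝ}

/-- The knots `x_i`, `i ∈ ℤ`, with the boundary knots repeated:
`x_i = x_0` for `i < 0` and `x_i = x_m` for `i > m`. -/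
def x (P : KnotPartition a b) (i : ℤ) : ℝ := P.knot (min i.toNat P.size)

/-- The step lengths `h_i = x_i - x_{i-1}`; thus `h_0 = h_{m+1} = 0`. -/
def h (P : KnotPartition a b) (i : ℤ) : ℝ := P.x i - P.x (i - 1)

/-- The midpoints `s_i = (x_{i-1} + x_i) / 2`; thus `s_0 = x_0` and `s_{m+1} = x_m`. -/
noncomputable def mid (P : KnotPartition a b) (i : ℤ) : ℝ := (P.x (i - 1) + P.x i) / 2

/-- `σ_i = h_i / (h_{i-1} + h_i)`, used for `1 ≤ i ≤ m + 1`; thus `σ_1 = 1`, `σ_{m+1} = 0`. -/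
noncomputable def sigma (P : KnotPartition a b) (i : ℤ) : ℝ := P.h i / (P.h (i - 1) + P.h i)

/-- `σ'_i = h_{i-1} / (h_{i-1} + h_i)`, used for `1 ≤ i ≤ m + 1`; thus `σ'_1 = 0`,
`σ'_{m+1} = 1`. -/
noncomputable def sigma' (P : KnotPartition a b) (i : ℤ) : ℝ :=
  P.h (i - 1) / (P.h (i - 1) + P.h i)

/-- The largest step length of the partition (the `h_i` with `i = 0` and `i = m + 1` are zero). -/
noncomputable def maxStep (P : KnotPartition a b) : ℝ :=
  (Finset.Icc (0 : ℤ) (P.size + 1)).sup' ⟨0, by simp; omega⟩ P.h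

/-- The coefficients `a_i = - σ_i² σ'_{i+1} / (σ_i + σ'_{i+1})` for `1 ≤ i ≤ m`, and
`a_0 = a_{m+1} = 0`. -/
noncomputable def coefA (P : KnotPartition a b) (i : ℤ) : ℝ :=
  if 1 ≤ i ∧ i ≤ P.size then
    -(P.sigma i ^ 2 * P.sigma' (i + 1) / (P.sigma i + P.sigma' (i + 1)))
  else 0

/-- The coefficients `c_i = - σ_i (σ'_{i+1})² / (σ_i + σ'_{i+1})` for `1 ≤ i ≤ m`, and
`c_0 = c_{m+1} = 0`. -/
noncomputable def coefC (P : KnotPartition a b) (i : ℤ) : ℝ :=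
  if 1 ≤ i ∧ i ≤ P.size then
    -(P.sigma i * P.sigma' (i + 1) ^ 2 / (P.sigma i + P.sigma' (i + 1)))
  else 0

/-- The value at the knot `x_p` (`0 ≤ p ≤ m`) of the univariate quadratic B-spline with knots
`x_{i-2}, x_{i-1}, x_i, x_{i+1}` (`0 ≤ i ≤ m + 1`): `σ'_i` at `x_{i-1}`, `σ_{i+1}` at `x_i`,
and `0` at the other knots. -/
noncomputable def knotValue (P : KnotPartition a b) (i p : ℤ) : ℝ :=
  if p = i - 1 then P.sigma' i else if p = i then P.sigma (i + 1) else 0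

open Classical in
/-- An index `r ∈ {1, …, m}` with `x_{r-1} ≤ t ≤ x_r`, for `t ∈ [a, b]`. At an interior knot the
interval on the right is taken. -/
noncomputable def cell (P : KnotPartition a b) (t : ℝ) : ℕ :=
  Nat.findGreatest (fun r => P.knot r ≤ t) (P.size - 1) + 1

end KnotPartition

/-- The quadratic polynomial on a triangle `ABC` with Bernstein-Bézier coefficients `bA, bB, bC`
at the vertices and `bAB, bBC, bCA` at the midpoints of the sides, at the point with barycentric
coordinates `α, β, γ`. -/
def bernsteinQuadratic (bA bB bC bAB bBC bCA α β γ : ℝ) : ℝ :=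
  bA * α ^ 2 + bB * β ^ 2 + bC * γ ^ 2
    + 2 * bAB * (α * β) + 2 * bBC * (β * γ) + 2 * bCA * (γ * α)

/-- The `C¹` piecewise quadratic function on the square `[0,1]²`, divided into four triangles by
its diagonals, given by its Bernstein-Bézier coefficients at the four corners (`sw, se, nw, ne`)
and at the midpoints of the four sides (`s, e, n, w`). The `C¹` conditions determine the other
coefficients: at the midpoint between the centre and a corner it is the mean of those at the
midpoints of the two adjacent sides, at the centre it is the mean of those of the four sides. -/
noncomputable def crissCrossQuadratic (sw se nw ne s e n w u v : ℝ) : ℝ :=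
  let msw := (s + w) / 2
  let mse := (s + e) / 2
  let mnw := (n + w) / 2
  let mne := (n + e) / 2
  let z := (s + e + n + w) / 4
  if v ≤ u then
    if u + v ≤ 1 then
      -- lower triangle `(0,0), (1,0), (1/2,1/2)`
      bernsteinQuadratic sw se z s mse msw (1 - u - v) (u - v) (2 * v)
    else
      -- right triangle `(1,0), (1,1), (1/2,1/2)`
      bernsteinQuadratic se ne z e mne mse (u - v) (u + v - 1) (2 * (1 - u))
  else
    if u + v ≤ 1 then
      -- left triangle `(0,0), (0,1), (1/2,1/2)`
      bernsteinQuadratic sw nw z w mnw msw (1 - u - v) (v - u) (2 * u)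
    else
      -- upper triangle `(0,1), (1,1), (1/2,1/2)`
      bernsteinQuadratic nw ne z n mne mnw (v - u) (u + v - 1) (2 * (1 - v))

/-- The closed rectangle `[a,b] × [c,d]` in the Euclidean plane. -/
def rectangle (a b c d : ℝ) : Set (EuclideanSpace ℝ (Fin 2)) :=
  {p | p 0 ∈ Set.Icc a b ∧ p 1 ∈ Set.Icc c d}

section CrissCross

variable {a b c d : ℝ} (X : KnotPartition a b) (Y : KnotPartition c d)

/-- The polynomial pieces of the B-spline `B_{ij}` on the subrectangle
`[x_{r-1}, x_r] × [y_{s-1}, y_s]`, divided by its two diagonals. The Bernstein-Bézier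
coefficients of `B_{ij}` are: at a vertex `(x_p, y_q)` the product of the values there of the
univariate B-splines; at the midpoint of a horizontal edge `[x_{r-1}, x_r] × {y_q}` the value at
`y_q` of the univariate B-spline in `y` if `r = i` and `0` otherwise; at the midpoint of a
vertical edge likewise. All pieces vanish outside the octagon centred at `(s_i, t_j)`. -/
noncomputable def crissCrossBSplinePiece (i j r s : ℤ) (p : EuclideanSpace ℝ (Fin 2)) : ℝ :=
  crissCrossQuadratic
    (X.knotValue i (r - 1) * Y.knotValue j (s - 1))
    (X.knotValue i r * Y.knotValue j (s - 1))
    (X.knotValue i (r - 1) * Y.knotValue j s)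
    (X.knotValue i r * Y.knotValue j s)
    (if r = i then Y.knotValue j (s - 1) else 0)
    (if s = j then X.knotValue i r else 0)
    (if r = i then Y.knotValue j s else 0)
    (if s = j then X.knotValue i (r - 1) else 0)
    ((p 0 - X.x (r - 1)) / X.h r)
    ((p 1 - Y.x (s - 1)) / Y.h s)

/-- The quadratic `C¹` B-spline `B_{ij}`, `0 ≤ i ≤ m + 1`, `0 ≤ j ≤ n + 1`, on the criss-cross
triangulation of the rectangle (evaluated at points of the rectangle). Since the boundary knots
are repeated, its support lies in the rectangle. -/
noncomputable def crissCrossBSpline (i j : ℤ) (p : EuclideanSpace ℝ (Fin 2)) : ℝ :=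
  crissCrossBSplinePiece X Y i j (X.cell (p 0)) (Y.cell (p 1)) p

/-- The vertices `A_{ij} = (x_i, y_j)`, with the boundary ones repeated for indices outside
`0 ≤ i ≤ m`, `0 ≤ j ≤ n`. -/
noncomputable def gridVertex (i j : ℤ) : EuclideanSpace ℝ (Fin 2) := !₂[X.x i, Y.x j]

/-- The points `M_{ij} = (s_i, t_j)`. -/
noncomputable def gridCenter (i j : ℤ) : EuclideanSpace ℝ (Fin 2) := !₂[X.mid i, Y.mid j]

/-- The coefficient functionals `μ_{ij}` of the quasi-interpolant `S_2`. -/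
noncomputable def muS (f : EuclideanSpace ℝ (Fin 2) → ℝ) (i j : ℤ) : ℝ :=
  (1 - (X.coefA i + X.coefC i + Y.coefA j + Y.coefC j)) * f (gridCenter X Y i j)
    + X.coefA i * f (gridCenter X Y (i - 1) j) + X.coefC i * f (gridCenter X Y (i + 1) j)
    + Y.coefA j * f (gridCenter X Y i (j - 1)) + Y.coefC j * f (gridCenter X Y i (j + 1))

/-- The coefficient functionals `μ*_{ij}` of the modified Chui-Wang quasi-interpolant `W_2*`. -/
noncomputable def muW (f : EuclideanSpace ℝ (Fin 2) → ℝ) (i j : ℤ) : ℝ :=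
  2 * f (gridCenter X Y i j)
    - 1 / 4 * (f (gridVertex X Y (i - 1) (j - 1)) + f (gridVertex X Y (i - 1) j)
      + f (gridVertex X Y i (j - 1)) + f (gridVertex X Y i j))

/-- The quasi-interpolant `S_2 f`. -/
noncomputable def quasiS (f : EuclideanSpace ℝ (Fin 2) → ℝ) (p : EuclideanSpace ℝ (Fin 2)) : ℝ :=
  ∑ i ∈ Finset.Icc (0 : ℤ) (X.size + 1), ∑ j ∈ Finset.Icc (0 : ℤ) (Y.size + 1),
    muS X Y f i j * crissCrossBSpline X Y i j p

/-- The quasi-interpolant `W_2* f`. -/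
noncomputable def quasiW (f : EuclideanSpace ℝ (Fin 2) → ℝ) (p : EuclideanSpace ℝ (Fin 2)) : ℝ :=
  ∑ i ∈ Finset.Icc (0 : ℤ) (X.size + 1), ∑ j ∈ Finset.Icc (0 : ℤ) (Y.size + 1),
    muW X Y f i j * crissCrossBSpline X Y i j p

/-- The maximal step length `h = max {h_i, k_j}`. -/
noncomputable def meshSize : ℝ := max X.maxStep Y.maxStep

end CrissCross

/-- The modulus of continuity
`ω(ψ, t) = sup {|ψ(M) - ψ(P)| : M, P ∈ Ω, ‖M - P‖ ≤ t}` with the Euclidean norm (a maximum for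
`ψ` continuous on a compact `Ω`). -/
noncomputable def modulusOn (Ω : Set (EuclideanSpace ℝ (Fin 2)))
    (ψ : EuclideanSpace ℝ (Fin 2) → ℝ) (t : ℝ) : ℝ :=
  sSup {e | ∃ M ∈ Ω, ∃ P ∈ Ω, dist M P ≤ t ∧ e = |ψ M - ψ P|}

/-- The set of absolute values of `g` on `Ω`. -/
def absValuesOn (Ω : Set (EuclideanSpace ℝ (Fin 2)))
    (g : EuclideanSpace ℝ (Fin 2) → ℝ) : Set ℝ := (fun p => |g p|) '' Ω

/-- The supremum norm over `Ω` (of a function bounded on `Ω`). -/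
noncomputable def supNormOn (Ω : Set (EuclideanSpace ℝ (Fin 2)))
    (g : EuclideanSpace ℝ (Fin 2) → ℝ) : ℝ := sSup (absValuesOn Ω g)

/-! At each point `p` of the rectangle the values of the B-splines are nonnegative and sum to 1, so
`f p - Q f p` is a convex combination of the differences between `f p` and the coefficient
functionals. Only indices within 1 of the cell of `p` contribute, and for these the centre `M_ij`
differs from `p` by at most `3h/2` in each coordinate. Walking there parallel to the axes in steps
of length at most `h/2` costs 3 + 3 = 6 moduli (`abs_sub_gridCenter_le`).

It remains to compare `f (M_ij)` with the functional. For `S_2` the bound `|a_i| + |c_i| ≤ 1` in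
each direction and the distance at most `h` between neighbouring centres give 4 moduli. For `W_2*`
the difference is a mean of differences between a centre and the vertices of its cell, which gives
2. The resulting constants 10 and 8 lie below those claimed. -/

open Finset in
/-- A convex combination, with weights `B`, of numbers `μ i j` that lie within `C` of `y` wherever
`B` does not vanish, lies within `C` of `y`. -/
theorem abs_sub_sum_mul_le_of_partition_of_unity {ι κ : Type*} (I : Finset ι) (J : Finset κ)
    (B μ : ι → κ → ℝ) (y C : ℝ) (hB : ∀ i j, 0 ≤ B i j) (hsum : ∑ i ∈ I, ∑ j ∈ J, B i j = 1)
    (hμ : ∀ i j, B i j ≠ 0 → |y - μ i j| ≤ C) :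
    |y - ∑ i ∈ I, ∑ j ∈ J, μ i j * B i j| ≤ C := by
  have key : y - ∑ i ∈ I, ∑ j ∈ J, μ i j * B i j = ∑ i ∈ I, ∑ j ∈ J, (y - μ i j) * B i j := by
    simp only [sub_mul, sum_sub_distrib, ← mul_sum, hsum, mul_one]
  have hterm : ∀ i j, |(y - μ i j) * B i j| ≤ C * B i j := by
    intro i j
    rw [abs_mul, abs_of_nonneg (hB i j)]
    by_cases h0 : B i j = 0
    · simp [h0]
    · exact mul_le_mul_of_nonneg_right (hμ i j h0) (hB i j)
  calc |y - ∑ i ∈ I, ∑ j ∈ J, μ i j * B i j|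
      ≤ ∑ i ∈ I, ∑ j ∈ J, |(y - μ i j) * B i j| := by
        rw [key]
        exact (abs_sum_le_sum_abs _ _).trans
          (sum_le_sum fun i _ => abs_sum_le_sum_abs _ _)
    _ ≤ ∑ i ∈ I, ∑ j ∈ J, C * B i j :=
        sum_le_sum fun i _ => sum_le_sum fun j _ => hterm i j
    _ = C := by simp only [← mul_sum, hsum, mul_one]

/-! ### Univariate partitions: steps, knot values and distances -/

namespace KnotPartition

variable {a b : ℝ} (P : KnotPartition a b)

theorem h_nonneg (i : ℤ) : 0 ≤ P.h i := by
  unfold h x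
  rcases le_or_gt i 0 with hi | hi
  · rw [show i.toNat = 0 by omega, show (i - 1).toNat = 0 by omega, sub_self]
  · obtain ⟨n, rfl⟩ : ∃ n : ℕ, i = n + 1 := ⟨(i - 1).toNat, by omega⟩
    rw [show ((n : ℤ) + 1).toNat = n + 1 by omega, show ((n : ℤ) + 1 - 1).toNat = n by omega]
    rcases lt_or_ge n P.size with hn | hn
    · rw [min_eq_left (by omega), min_eq_left (by omega)]
      linarith [P.knot_lt n hn]
    · rw [min_eq_right (by omega), min_eq_right (by omega), sub_self]

theorem h_pos {i : ℤ} (h1 : 1 ≤ i) (h2 : i ≤ P.size) : 0 < P.h i := by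
  unfold h x
  obtain ⟨n, rfl⟩ : ∃ n : ℕ, i = n + 1 := ⟨(i - 1).toNat, by omega⟩
  rw [show ((n : ℤ) + 1).toNat = n + 1 by omega, show ((n : ℤ) + 1 - 1).toNat = n by omega,
    min_eq_left (by omega), min_eq_left (by omega)]
  linarith [P.knot_lt n (by omega)]

theorem x_monotone : Monotone P.x := by
  refine monotone_int_of_le_succ fun i => ?_
  have := P.h_nonneg (i + 1)
  rw [h, add_sub_cancel_right] at this
  linarith

theorem x_mem_Icc (i : ℤ) : P.x i ∈ Set.Icc a b := by
  have h0 : P.x 0 = a := by simp [x, P.knot_zero]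
  have hm : P.x P.size = b := by simp [x, P.knot_size]
  constructor
  · rcases le_total 0 i with hi | hi
    · exact h0.symm.le.trans (P.x_monotone hi)
    · simp [x, show i.toNat = 0 by omega, P.knot_zero]
  · rcases le_total i P.size with hi | hi
    · exact (P.x_monotone hi).trans hm.le
    · simp [x, show P.size ≤ i.toNat by omega, P.knot_size]

theorem mid_mem_Icc (i : ℤ) : P.mid i ∈ Set.Icc a b := by
  have h1 := P.x_mem_Icc i
  have h2 := P.x_mem_Icc (i - 1)
  simp only [Set.mem_Icc, mid] at *
  constructor <;> linarith

/-- Repeated knots give zero steps outside the index range, so later estimates can move to `i ± 1`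
without range conditions. -/
theorem h_le_maxStep (i : ℤ) : P.h i ≤ P.maxStep := by
  by_cases hi : i ∈ Finset.Icc (0 : ℤ) (P.size + 1)
  · exact Finset.le_sup' P.h hi
  · have h0 : P.h i = 0 := by
      rw [Finset.mem_Icc, not_and_or, not_le, not_le] at hi
      unfold h x
      rcases hi with hi | hi
      · rw [show i.toNat = 0 by omega, show (i - 1).toNat = 0 by omega, sub_self]
      · rw [min_eq_right (by omega), min_eq_right (by omega), sub_self]
    rw [h0]
    refine (P.h_nonneg 0).trans (Finset.le_sup' P.h ?_)
    rw [Finset.mem_Icc]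
    omega

theorem sigma_nonneg (i : ℤ) : 0 ≤ P.sigma i :=
  div_nonneg (P.h_nonneg i) (add_nonneg (P.h_nonneg _) (P.h_nonneg i))

theorem sigma'_nonneg (i : ℤ) : 0 ≤ P.sigma' i :=
  div_nonneg (P.h_nonneg _) (add_nonneg (P.h_nonneg _) (P.h_nonneg i))

theorem sigma_le_one (i : ℤ) : P.sigma i ≤ 1 :=
  div_le_one_of_le₀ (le_add_of_nonneg_left (P.h_nonneg _))
    (add_nonneg (P.h_nonneg _) (P.h_nonneg i))

theorem sigma'_le_one (i : ℤ) : P.sigma' i ≤ 1 :=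
  div_le_one_of_le₀ (le_add_of_nonneg_right (P.h_nonneg _))
    (add_nonneg (P.h_nonneg _) (P.h_nonneg i))

theorem sigma_add_sigma' {i : ℤ} (h1 : 1 ≤ i) (h2 : i ≤ P.size + 1) :
    P.sigma i + P.sigma' i = 1 := by
  have hpos : 0 < P.h (i - 1) + P.h i := by
    rcases le_or_gt i P.size with hi | hi
    · exact add_pos_of_nonneg_of_pos (P.h_nonneg _) (P.h_pos h1 hi)
    -- At `i = m + 1` the last step `h_m` keeps the denominator positive, which needs `m ≥ 1`.
    · have := P.size_pos
      exact add_pos_of_pos_of_nonneg (P.h_pos (by omega) (by omega)) (P.h_nonneg _)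
  rw [sigma, sigma', ← add_div, add_comm, div_self hpos.ne']

/-- With `s = σ_i` and `t = σ'_{i+1}` the sum is `(s²t + st²)/(s + t) = st`, a product of numbers in
`[0,1]`. -/
theorem abs_coefA_add_abs_coefC_le_one (i : ℤ) : |P.coefA i| + |P.coefC i| ≤ 1 := by
  unfold coefA coefC
  split_ifs
  · have hs := P.sigma_nonneg i
    have ht := P.sigma'_nonneg (i + 1)
    have hs1 := P.sigma_le_one i
    have ht1 := P.sigma'_le_one (i + 1)
    generalize P.sigma i = s at *
    generalize P.sigma' (i + 1) = t at *
    rw [abs_neg, abs_neg, abs_of_nonneg (by positivity), abs_of_nonneg (by positivity),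
      ← add_div]
    refine div_le_one_of_le₀ ?_ (by positivity)
    have hst : s * t ≤ 1 := mul_le_one₀ hs1 ht ht1
    nlinarith [mul_le_mul_of_nonneg_right hst (add_nonneg hs ht)]
  · simp

theorem knotValue_nonneg (i p : ℤ) : 0 ≤ P.knotValue i p := by
  unfold knotValue
  split_ifs
  exacts [P.sigma'_nonneg _, P.sigma_nonneg _, le_rfl]

theorem knotValue_eq_zero {i p : ℤ} (h1 : i ≠ p) (h2 : i ≠ p + 1) : P.knotValue i p = 0 := by
  rw [knotValue, if_neg (by omega), if_neg (by omega)]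

/-- Only `i = p` and `i = p + 1` contribute, with values `σ_{p+1}` and `σ'_{p+1}`. -/
theorem sum_knotValue {p : ℤ} (h1 : 0 ≤ p) (h2 : p ≤ P.size) :
    ∑ i ∈ Finset.Icc (0 : ℤ) (P.size + 1), P.knotValue i p = 1 := by
  rw [Finset.sum_eq_add_of_mem p (p + 1) (by rw [Finset.mem_Icc]; omega)
    (by rw [Finset.mem_Icc]; omega) (by omega)
    (fun i _ hi => P.knotValue_eq_zero hi.1 hi.2)]
  rw [knotValue, knotValue, if_neg (by omega), if_pos rfl, if_pos (by omega)]
  exact P.sigma_add_sigma' (by omega) (by omega)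

theorem one_le_cell (t : ℝ) : 1 ≤ P.cell t := by simp [cell]

theorem cell_le_size (t : ℝ) : P.cell t ≤ P.size := by
  classical
  have h1 := Nat.findGreatest_le (P := fun r => P.knot r ≤ t) (P.size - 1)
  have h2 := P.size_pos
  unfold cell
  convert (show Nat.findGreatest (fun r => P.knot r ≤ t) (P.size - 1) + 1 ≤ P.size by omega)

theorem x_cell_sub_one_le {t : ℝ} (ht : a ≤ t) : P.x (P.cell t - 1) ≤ t := by
  have h1 := P.cell_le_size t
  rw [x, show ((P.cell t : ℤ) - 1).toNat = P.cell t - 1 by omega, min_eq_left (by omega)]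
  unfold cell
  rw [Nat.add_sub_cancel]
  exact Nat.findGreatest_spec (P := fun r => P.knot r ≤ t) (Nat.zero_le _)
    (P.knot_zero.le.trans ht)

theorem le_x_cell {t : ℝ} (ht : t ≤ b) : t ≤ P.x (P.cell t) := by
  have h1 := P.cell_le_size t
  rw [x, Int.toNat_natCast, min_eq_left h1]
  -- The last cell ends at `b`; for any other cell, maximality of the chosen index puts its right
  -- knot beyond `t`.
  rcases h1.eq_or_lt with h2 | h2
  · rwa [h2, P.knot_size]
  · unfold cell at h2 ⊢
    exact (not_le.1 (Nat.findGreatest_is_greatest (P := fun r => P.knot r ≤ t)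
      (Nat.lt_succ_self _) (by omega))).le

/-- The worst case crosses the whole cell and half of an adjacent one. Distances are written as
multiples of `H / 2` to count steps for the modulus. -/
theorem abs_sub_mid_le {t H : ℝ} {r i : ℤ} (hH : ∀ k, P.h k ≤ H) (h1 : P.x (r - 1) ≤ t)
    (h2 : t ≤ P.x r) (hi : r - 1 ≤ i) (hi' : i ≤ r + 1) : |t - P.mid i| ≤ 3 * (H / 2) := by
  have a0 := hH (r - 1)
  have a1 := hH r
  have a2 := hH (r + 1)
  have b0 := P.h_nonneg (r - 1)
  have b1 := P.h_nonneg r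
  have b2 := P.h_nonneg (r + 1)
  simp only [h] at a0 a1 a2 b0 b1 b2
  rw [add_sub_cancel_right] at a2 b2
  obtain rfl | rfl | rfl : i = r - 1 ∨ i = r ∨ i = r + 1 := by omega
  all_goals
    rw [mid, abs_le]
    try rw [add_sub_cancel_right]
    constructor <;> linarith

theorem abs_mid_sub_mid_sub_one_le {H : ℝ} (hH : ∀ k, P.h k ≤ H) (i : ℤ) :
    |P.mid i - P.mid (i - 1)| ≤ 2 * (H / 2) := by
  have a0 := hH (i - 1)
  have a1 := hH i
  have b0 := P.h_nonneg (i - 1)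
  have b1 := P.h_nonneg i
  simp only [h] at a0 a1 b0 b1
  rw [mid, mid, abs_le]
  constructor <;> linarith

theorem abs_mid_sub_mid_add_one_le {H : ℝ} (hH : ∀ k, P.h k ≤ H) (i : ℤ) :
    |P.mid i - P.mid (i + 1)| ≤ 2 * (H / 2) := by
  simpa [abs_sub_comm] using P.abs_mid_sub_mid_sub_one_le hH (i + 1)

theorem abs_mid_sub_x_le {H : ℝ} (hH : ∀ k, P.h k ≤ H) (i : ℤ) :
    |P.mid i - P.x i| ≤ H / 2 := by
  have a1 := hH i
  have b1 := P.h_nonneg i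
  simp only [h] at a1 b1
  rw [mid, abs_le]
  constructor <;> linarith

theorem abs_mid_sub_x_sub_one_le {H : ℝ} (hH : ∀ k, P.h k ≤ H) (i : ℤ) :
    |P.mid i - P.x (i - 1)| ≤ H / 2 := by
  have a1 := hH i
  have b1 := P.h_nonneg i
  simp only [h] at a1 b1
  rw [mid, abs_le]
  constructor <;> linarith

end KnotPartition

/-! ### Criss-cross quadratics as convex combinations -/

/-- On the unit square the values of a criss-cross quadratic are convex combinations of its
coefficients at the corners and at the midpoints of the sides. -/
theorem exists_weights_crissCrossQuadratic {u v : ℝ} (hu : u ∈ Set.Icc (0 : ℝ) 1)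
    (hv : v ∈ Set.Icc (0 : ℝ) 1) :
    ∃ w : Fin 8 → ℝ, (∀ k, 0 ≤ w k) ∧ ∑ k, w k = 1 ∧ ∀ sw se nw ne s e n ww : ℝ,
      crissCrossQuadratic sw se nw ne s e n ww u v =
        w 0 * sw + w 1 * se + w 2 * nw + w 3 * ne + w 4 * s + w 5 * e + w 6 * n + w 7 * ww := by
  obtain ⟨hu0, hu1⟩ := hu
  obtain ⟨hv0, hv1⟩ := hv
  unfold crissCrossQuadratic bernsteinQuadratic
  -- One case per triangle: lower, right, left, upper. The weights arise by distributing each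
  -- Bernstein monomial over the side midpoints whose mean is its coefficient; they total `(α + β +
  -- γ)² = 1` and do not depend on the coefficients.
  by_cases h1 : v ≤ u <;> by_cases h2 : u + v ≤ 1
  · obtain ⟨α, hα⟩ : ∃ α, α = 1 - u - v := ⟨_, rfl⟩
    obtain ⟨β, hβ⟩ : ∃ β, β = u - v := ⟨_, rfl⟩
    have ha : 0 ≤ α := by linarith
    have hb : 0 ≤ β := by linarith
    refine ⟨![α ^ 2, β ^ 2, 0, 0, v ^ 2 + 2 * α * β + 2 * v * β + 2 * v * α,
      v ^ 2 + 2 * v * β, v ^ 2, v ^ 2 + 2 * v * α], ?_, ?_, ?_⟩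
    · intro k; fin_cases k <;> simp <;> positivity
    · simp [Fin.sum_univ_eight]; subst hα hβ; ring
    · intros; simp [h1, h2, ← hα, ← hβ]; ring
  · obtain ⟨α, hα⟩ : ∃ α, α = u - v := ⟨_, rfl⟩
    obtain ⟨β, hβ⟩ : ∃ β, β = u + v - 1 := ⟨_, rfl⟩
    obtain ⟨z, hz⟩ : ∃ z, z = 1 - u := ⟨_, rfl⟩
    have ha : 0 ≤ α := by linarith
    have hb : 0 ≤ β := by linarith
    have hc : 0 ≤ z := by linarith
    refine ⟨![0, α ^ 2, 0, β ^ 2, z ^ 2 + 2 * z * α,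
      z ^ 2 + 2 * α * β + 2 * z * β + 2 * z * α, z ^ 2 + 2 * z * β, z ^ 2], ?_, ?_, ?_⟩
    · intro k; fin_cases k <;> simp <;> positivity
    · simp [Fin.sum_univ_eight]; subst hα hβ hz; ring
    · intros; simp [h1, h2, ← hα, ← hβ, ← hz]; ring
  · obtain ⟨α, hα⟩ : ∃ α, α = 1 - u - v := ⟨_, rfl⟩
    obtain ⟨β, hβ⟩ : ∃ β, β = v - u := ⟨_, rfl⟩
    have ha : 0 ≤ α := by linarith
    have hb : 0 ≤ β := by linarith
    refine ⟨![α ^ 2, 0, β ^ 2, 0, u ^ 2 + 2 * u * α, u ^ 2, u ^ 2 + 2 * u * β,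
      u ^ 2 + 2 * α * β + 2 * u * β + 2 * u * α], ?_, ?_, ?_⟩
    · intro k; fin_cases k <;> simp <;> positivity
    · simp [Fin.sum_univ_eight]; subst hα hβ; ring
    · intros; simp [h1, h2, ← hα, ← hβ]; ring
  · obtain ⟨α, hα⟩ : ∃ α, α = v - u := ⟨_, rfl⟩
    obtain ⟨β, hβ⟩ : ∃ β, β = u + v - 1 := ⟨_, rfl⟩
    obtain ⟨z, hz⟩ : ∃ z, z = 1 - v := ⟨_, rfl⟩
    have ha : 0 ≤ α := by linarith
    have hb : 0 ≤ β := by linarith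
    have hc : 0 ≤ z := by linarith
    refine ⟨![0, 0, α ^ 2, β ^ 2, z ^ 2, z ^ 2 + 2 * z * β,
      z ^ 2 + 2 * α * β + 2 * z * β + 2 * z * α, z ^ 2 + 2 * z * α], ?_, ?_, ?_⟩
    · intro k; fin_cases k <;> simp <;> positivity
    · simp [Fin.sum_univ_eight]; subst hα hβ hz; ring
    · intros; simp [h1, h2, ← hα, ← hβ, ← hz]; ring

/-! ### Compactness and convexity of the rectangle -/

section Rectangle

variable {a b c d : ℝ}

theorem isCompact_rectangle : IsCompact (rectangle a b c d) := by
  have h : rectangle a b c d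
      = (fun z : ℝ × ℝ => (!₂[z.1, z.2] : EuclideanSpace ℝ (Fin 2))) ''
        (Set.Icc a b ×ˢ Set.Icc c d) := by
    ext p
    constructor
    · intro hp
      refine ⟨(p 0, p 1), hp, ?_⟩
      ext k
      fin_cases k <;> rfl
    · rintro ⟨z, hz, rfl⟩
      exact hz
  rw [h]
  exact (isCompact_Icc.prod isCompact_Icc).image (by fun_prop)

theorem convex_rectangle : Convex ℝ (rectangle a b c d) := by
  intro p hp q hq s t hs ht hst
  exact ⟨convex_Icc a b hp.1 hq.1 hs ht hst, convex_Icc c d hp.2 hq.2 hs ht hst⟩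

end Rectangle

/-! ### The modulus of continuity and the supremum norm -/

section Modulus

variable {Ω : Set (EuclideanSpace ℝ (Fin 2))} {f : EuclideanSpace ℝ (Fin 2) → ℝ}

theorem abs_sub_le_modulusOn (hΩ : IsCompact Ω) (hf : ContinuousOn f Ω) {t : ℝ}
    {p q : EuclideanSpace ℝ (Fin 2)} (hp : p ∈ Ω) (hq : q ∈ Ω) (h : dist p q ≤ t) :
    |f p - f q| ≤ modulusOn Ω f t := by
  obtain ⟨K, hK⟩ := hΩ.exists_bound_of_continuousOn hf
  -- Compactness bounds the set of differences, so `sSup` is a genuine supremum.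
  refine le_csSup ⟨K + K, ?_⟩ ⟨p, hp, q, hq, h, rfl⟩
  rintro e ⟨M, hM, P, hP, -, rfl⟩
  exact (abs_sub _ _).trans (add_le_add (hK M hM) (hK P hP))

theorem modulusOn_nonneg (t : ℝ) : 0 ≤ modulusOn Ω f t := by
  refine Real.sSup_nonneg ?_
  rintro e ⟨M, -, P, -, -, rfl⟩
  exact abs_nonneg _

theorem abs_sub_le_nat_mul_modulusOn (hΩ : IsCompact Ω) (hc : Convex ℝ Ω)
    (hf : ContinuousOn f Ω) {t : ℝ} (n : ℕ) {p q : EuclideanSpace ℝ (Fin 2)} (hp : p ∈ Ω)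
    (hq : q ∈ Ω) (h : dist p q ≤ n * t) : |f p - f q| ≤ n * modulusOn Ω f t := by
  induction n generalizing q with
  | zero =>
    have : p = q := dist_le_zero.1 (by simpa using h)
    simp [this]
  | succ n ih =>
    have hn : (0 : ℝ) < (n : ℝ) + 1 := by positivity
    push_cast at h ⊢
    have hd : dist p q / ((n : ℝ) + 1) ≤ t := by
      rw [div_le_iff₀ hn]; linarith
    -- Cutting the segment into `n + 1` equal pieces, `z` is the last division point; convexity
    -- keeps it in `Ω`.
    set z := AffineMap.lineMap (k := ℝ) p q ((n : ℝ) / (n + 1)) with hz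
    have hzΩ : z ∈ Ω := hc.lineMap_mem hp hq
      ⟨by positivity, div_le_one_of_le₀ (by linarith) hn.le⟩
    have h1 : dist p z ≤ n * t := by
      rw [hz, dist_left_lineMap, Real.norm_of_nonneg (by positivity), div_mul_eq_mul_div,
        mul_div_assoc]
      exact mul_le_mul_of_nonneg_left hd (by positivity)
    have h2 : dist z q ≤ t := by
      have e : 1 - (n : ℝ) / (n + 1) = 1 / (n + 1) := by field_simp; ring
      rw [hz, dist_lineMap_right, e, Real.norm_of_nonneg (by positivity), one_div_mul_eq_div]
      exact hd
    have h3 := ih hzΩ h1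
    have h4 := abs_sub_le_modulusOn hΩ hf hzΩ hq h2
    linarith [abs_sub_le (f p) (f z) (f q)]

theorem abs_sub_le_add_mul_modulusOn_rectangle {a b c d : ℝ}
    (hf : ContinuousOn f (rectangle a b c d)) {t : ℝ} (m n : ℕ)
    {p q : EuclideanSpace ℝ (Fin 2)} (hp : p ∈ rectangle a b c d) (hq : q ∈ rectangle a b c d)
    (h0 : |p 0 - q 0| ≤ m * t) (h1 : |p 1 - q 1| ≤ n * t) :
    |f p - f q| ≤ (m + n) * modulusOn (rectangle a b c d) f t := by
  -- The corner of an axis-parallel path from `p` to `q`: on each leg the Euclidean distance is a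
  -- single coordinate difference.
  set z : EuclideanSpace ℝ (Fin 2) := !₂[q 0, p 1] with hz
  have hzΩ : z ∈ rectangle a b c d := ⟨hq.1, hp.2⟩
  have e0 : dist p z = |p 0 - q 0| := by
    simp [EuclideanSpace.dist_eq, hz, Real.dist_eq, Real.sqrt_sq_eq_abs]
  have e1 : dist z q = |p 1 - q 1| := by
    simp [EuclideanSpace.dist_eq, hz, Real.dist_eq, Real.sqrt_sq_eq_abs]
  have h3 := abs_sub_le_nat_mul_modulusOn isCompact_rectangle convex_rectangle hf m hp hzΩ
    (e0.trans_le h0)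
  have h4 := abs_sub_le_nat_mul_modulusOn isCompact_rectangle convex_rectangle hf n hzΩ hq
    (e1.trans_le h1)
  linarith [abs_sub_le (f p) (f z) (f q)]

/-- Boundedness is recorded because `sSup` of an unbounded set of reals is 0, which would make the
norm bound meaningless. -/
theorem bddAbove_and_supNormOn_le {g : EuclideanSpace ℝ (Fin 2) → ℝ} {C : ℝ} (hC : 0 ≤ C)
    (hg : ∀ p ∈ Ω, |g p| ≤ C) : BddAbove (absValuesOn Ω g) ∧ supNormOn Ω g ≤ C := by
  have h : ∀ e ∈ absValuesOn Ω g, e ≤ C := by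
    rintro e ⟨p, hp, rfl⟩
    exact hg p hp
  exact ⟨⟨C, h⟩, Real.sSup_le h hC⟩

end Modulus

/-! ### B-splines: positivity, partition of unity, local support -/

section CrissCross

variable {a b c d : ℝ} (X : KnotPartition a b) (Y : KnotPartition c d)

theorem gridCenter_mem_rectangle (i j : ℤ) : gridCenter X Y i j ∈ rectangle a b c d :=
  ⟨X.mid_mem_Icc i, Y.mid_mem_Icc j⟩

theorem gridVertex_mem_rectangle (i j : ℤ) : gridVertex X Y i j ∈ rectangle a b c d :=
  ⟨X.x_mem_Icc i, Y.x_mem_Icc j⟩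

theorem h_le_meshSize_left (i : ℤ) : X.h i ≤ meshSize X Y :=
  (X.h_le_maxStep i).trans (le_max_left _ _)

theorem h_le_meshSize_right (j : ℤ) : Y.h j ≤ meshSize X Y :=
  (Y.h_le_maxStep j).trans (le_max_right _ _)

theorem div_h_cell_mem_Icc {t : ℝ} (ht : t ∈ Set.Icc a b) :
    (t - X.x (X.cell t - 1)) / X.h (X.cell t) ∈ Set.Icc (0 : ℝ) 1 := by
  have h1 := X.x_cell_sub_one_le ht.1
  have h2 := X.le_x_cell ht.2
  have h3 := X.h_nonneg (X.cell t)
  refine ⟨div_nonneg (by linarith) h3, div_le_one_of_le₀ ?_ h3⟩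
  rw [KnotPartition.h]
  linarith

variable {p : EuclideanSpace ℝ (Fin 2)}

theorem crissCrossBSpline_nonneg (hp : p ∈ rectangle a b c d) (i j : ℤ) :
    0 ≤ crissCrossBSpline X Y i j p := by
  obtain ⟨w, hw, -, hq⟩ := exists_weights_crissCrossQuadratic (div_h_cell_mem_Icc X hp.1)
    (div_h_cell_mem_Icc Y hp.2)
  have hX := X.knotValue_nonneg i
  have hY := Y.knotValue_nonneg j
  have hi : ∀ (P : Prop) [Decidable P] (z : ℝ), 0 ≤ z → 0 ≤ if P then z else 0 := by
    intro P _ z hz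
    split_ifs
    exacts [hz, le_rfl]
  rw [crissCrossBSpline, crissCrossBSplinePiece, hq]
  repeat' apply add_nonneg
  all_goals refine mul_nonneg (hw _) ?_
  all_goals first
    | exact mul_nonneg (hX _) (hY _)
    | exact hi _ _ (hX _)
    | exact hi _ _ (hY _)

open Finset in
-- The same eight weights serve every `B_ij`, so it suffices that each of the eight coefficients
-- sums to 1 over `i, j`.
theorem sum_crissCrossBSpline (hp : p ∈ rectangle a b c d) :
    ∑ i ∈ Icc (0 : ℤ) (X.size + 1), ∑ j ∈ Icc (0 : ℤ) (Y.size + 1),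
      crissCrossBSpline X Y i j p = 1 := by
  obtain ⟨w, -, hw, hq⟩ := exists_weights_crissCrossQuadratic (div_h_cell_mem_Icc X hp.1)
    (div_h_cell_mem_Icc Y hp.2)
  have r1 := X.one_le_cell (p 0)
  have r2 := X.cell_le_size (p 0)
  have s1 := Y.one_le_cell (p 1)
  have s2 := Y.cell_le_size (p 1)
  have X0 := X.sum_knotValue (p := X.cell (p 0) - 1) (by omega) (by omega)
  have X1 := X.sum_knotValue (p := X.cell (p 0)) (by omega) (by omega)
  have Y0 := Y.sum_knotValue (p := Y.cell (p 1) - 1) (by omega) (by omega)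
  have Y1 := Y.sum_knotValue (p := Y.cell (p 1)) (by omega) (by omega)
  have hr : (X.cell (p 0) : ℤ) ∈ Icc (0 : ℤ) (X.size + 1) := by rw [mem_Icc]; omega
  have hs : (Y.cell (p 1) : ℤ) ∈ Icc (0 : ℤ) (Y.size + 1) := by rw [mem_Icc]; omega
  have iteX : ∀ k : ℤ → ℝ, ∑ j ∈ Icc (0 : ℤ) (Y.size + 1), k j = 1 →
      ∑ i ∈ Icc (0 : ℤ) (X.size + 1), ∑ j ∈ Icc (0 : ℤ) (Y.size + 1),
        (if (X.cell (p 0) : ℤ) = i then k j else 0) = 1 := by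
    intro k hk
    rw [sum_comm]
    simp only [sum_ite_eq, if_pos hr, hk]
  have iteY : ∀ k : ℤ → ℝ, ∑ i ∈ Icc (0 : ℤ) (X.size + 1), k i = 1 →
      ∑ i ∈ Icc (0 : ℤ) (X.size + 1), ∑ j ∈ Icc (0 : ℤ) (Y.size + 1),
        (if (Y.cell (p 1) : ℤ) = j then k i else 0) = 1 := by
    intro k hk
    simp only [sum_ite_eq, if_pos hs, hk]
  simp only [crissCrossBSpline, crissCrossBSplinePiece, hq, sum_add_distrib, ← mul_sum]
  rw [Fin.sum_univ_eight] at hw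
  simp only [X0, X1, Y0, Y1, iteX _ Y0, iteX _ Y1, iteY _ X0, iteY _ X1, mul_one]
  exact hw

/-- For indices farther from the cell all eight coefficients vanish. -/
theorem index_near_cell_of_crissCrossBSpline_ne_zero (hp : p ∈ rectangle a b c d) {i j : ℤ}
    (h : crissCrossBSpline X Y i j p ≠ 0) :
    ((X.cell (p 0) : ℤ) - 1 ≤ i ∧ i ≤ X.cell (p 0) + 1) ∧
      ((Y.cell (p 1) : ℤ) - 1 ≤ j ∧ j ≤ Y.cell (p 1) + 1) := by
  obtain ⟨w, -, -, hq⟩ := exists_weights_crissCrossQuadratic (div_h_cell_mem_Icc X hp.1)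
    (div_h_cell_mem_Icc Y hp.2)
  by_contra hcon
  refine h ?_
  rw [crissCrossBSpline, crissCrossBSplinePiece, hq]
  rw [not_and_or] at hcon
  rcases hcon with hcon | hcon
  · rw [X.knotValue_eq_zero (i := i) (p := X.cell (p 0)) (by omega) (by omega),
      X.knotValue_eq_zero (i := i) (p := X.cell (p 0) - 1) (by omega) (by omega)]
    have : (X.cell (p 0) : ℤ) ≠ i := by omega
    simp [this]
  · rw [Y.knotValue_eq_zero (i := j) (p := Y.cell (p 1)) (by omega) (by omega),
      Y.knotValue_eq_zero (i := j) (p := Y.cell (p 1) - 1) (by omega) (by omega)]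
    have : (Y.cell (p 1) : ℤ) ≠ j := by omega
    simp [this]

/-! ### Error estimates for the coefficient functionals and the splines -/

variable {f : EuclideanSpace ℝ (Fin 2) → ℝ}

theorem abs_sub_gridCenter_le (hf : ContinuousOn f (rectangle a b c d))
    (hp : p ∈ rectangle a b c d) {i j : ℤ} (h : crissCrossBSpline X Y i j p ≠ 0) :
    |f p - f (gridCenter X Y i j)|
      ≤ 6 * modulusOn (rectangle a b c d) f (meshSize X Y / 2) := by
  obtain ⟨⟨hi1, hi2⟩, hj1, hj2⟩ := index_near_cell_of_crissCrossBSpline_ne_zero X Y hp h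
  have := abs_sub_le_add_mul_modulusOn_rectangle hf 3 3 hp (gridCenter_mem_rectangle X Y i j)
    (X.abs_sub_mid_le (h_le_meshSize_left X Y) (X.x_cell_sub_one_le hp.1.1)
      (X.le_x_cell hp.1.2) hi1 hi2)
    (Y.abs_sub_mid_le (h_le_meshSize_right X Y) (Y.x_cell_sub_one_le hp.2.1)
      (Y.le_x_cell hp.2.2) hj1 hj2)
  norm_num at this
  exact this

theorem abs_gridCenter_sub_gridCenter_le_left (hf : ContinuousOn f (rectangle a b c d))
    {i i' : ℤ} (j : ℤ) (h : |X.mid i - X.mid i'| ≤ 2 * (meshSize X Y / 2)) :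
    |f (gridCenter X Y i j) - f (gridCenter X Y i' j)|
      ≤ 2 * modulusOn (rectangle a b c d) f (meshSize X Y / 2) := by
  have := abs_sub_le_add_mul_modulusOn_rectangle hf 2 0 (gridCenter_mem_rectangle X Y i j)
    (gridCenter_mem_rectangle X Y i' j) (t := meshSize X Y / 2)
    (by simpa [gridCenter] using h) (by simp [gridCenter])
  simpa using this

theorem abs_gridCenter_sub_gridCenter_le_right (hf : ContinuousOn f (rectangle a b c d))
    (i : ℤ) {j j' : ℤ} (h : |Y.mid j - Y.mid j'| ≤ 2 * (meshSize X Y / 2)) :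
    |f (gridCenter X Y i j) - f (gridCenter X Y i j')|
      ≤ 2 * modulusOn (rectangle a b c d) f (meshSize X Y / 2) := by
  have := abs_sub_le_add_mul_modulusOn_rectangle hf 0 2 (gridCenter_mem_rectangle X Y i j)
    (gridCenter_mem_rectangle X Y i j') (t := meshSize X Y / 2)
    (by simp [gridCenter]) (by simpa [gridCenter] using h)
  simpa using this

theorem abs_gridCenter_sub_gridVertex_le (hf : ContinuousOn f (rectangle a b c d))
    {i i' j j' : ℤ} (hi : |X.mid i - X.x i'| ≤ meshSize X Y / 2)
    (hj : |Y.mid j - Y.x j'| ≤ meshSize X Y / 2) :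
    |f (gridCenter X Y i j) - f (gridVertex X Y i' j')|
      ≤ 2 * modulusOn (rectangle a b c d) f (meshSize X Y / 2) := by
  have := abs_sub_le_add_mul_modulusOn_rectangle hf 1 1 (gridCenter_mem_rectangle X Y i j)
    (gridVertex_mem_rectangle X Y i' j') (t := meshSize X Y / 2)
    (by simpa [gridCenter, gridVertex] using hi) (by simpa [gridCenter, gridVertex] using hj)
  norm_num at this
  exact this

/-- The weights of `μ_ij` sum to 1, so the difference is a combination of `f (M_ij) - f
(neighbour)`, each at most 2 moduli, with absolute weights at most 1 in each direction. -/
theorem abs_gridCenter_sub_muS_le (hf : ContinuousOn f (rectangle a b c d)) (i j : ℤ) :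
    |f (gridCenter X Y i j) - muS X Y f i j|
      ≤ 4 * modulusOn (rectangle a b c d) f (meshSize X Y / 2) := by
  have hω := modulusOn_nonneg (Ω := rectangle a b c d) (f := f) (meshSize X Y / 2)
  have hX := h_le_meshSize_left X Y
  have hY := h_le_meshSize_right X Y
  have d1 := abs_gridCenter_sub_gridCenter_le_left X Y hf j (X.abs_mid_sub_mid_sub_one_le hX i)
  have d2 := abs_gridCenter_sub_gridCenter_le_left X Y hf j (X.abs_mid_sub_mid_add_one_le hX i)
  have d3 := abs_gridCenter_sub_gridCenter_le_right X Y hf i (Y.abs_mid_sub_mid_sub_one_le hY j)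
  have d4 := abs_gridCenter_sub_gridCenter_le_right X Y hf i (Y.abs_mid_sub_mid_add_one_le hY j)
  have cX := X.abs_coefA_add_abs_coefC_le_one i
  have cY := Y.abs_coefA_add_abs_coefC_le_one j
  unfold muS
  generalize modulusOn (rectangle a b c d) f (meshSize X Y / 2) = ω at *
  generalize f (gridCenter X Y i j) = z at *
  have e : ∀ s z₁ : ℝ, |z - z₁| ≤ 2 * ω → |s * (z - z₁)| ≤ |s| * (2 * ω) := fun s z₁ h => by
    rw [abs_mul]
    exact mul_le_mul_of_nonneg_left h (abs_nonneg s)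
  have d1 := abs_le.1 (e (X.coefA i) _ d1)
  have d2 := abs_le.1 (e (X.coefC i) _ d2)
  have d3 := abs_le.1 (e (Y.coefA j) _ d3)
  have d4 := abs_le.1 (e (Y.coefC j) _ d4)
  have c1 := mul_le_mul_of_nonneg_right cX hω
  have c2 := mul_le_mul_of_nonneg_right cY hω
  rw [abs_le]
  constructor <;> linarith

theorem abs_gridCenter_sub_muW_le (hf : ContinuousOn f (rectangle a b c d)) (i j : ℤ) :
    |f (gridCenter X Y i j) - muW X Y f i j|
      ≤ 2 * modulusOn (rectangle a b c d) f (meshSize X Y / 2) := by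
  have x0 := X.abs_mid_sub_x_sub_one_le (h_le_meshSize_left X Y) i
  have x1 := X.abs_mid_sub_x_le (h_le_meshSize_left X Y) i
  have y0 := Y.abs_mid_sub_x_sub_one_le (h_le_meshSize_right X Y) j
  have y1 := Y.abs_mid_sub_x_le (h_le_meshSize_right X Y) j
  have d1 := abs_le.1 (abs_gridCenter_sub_gridVertex_le X Y hf x0 y0)
  have d2 := abs_le.1 (abs_gridCenter_sub_gridVertex_le X Y hf x0 y1)
  have d3 := abs_le.1 (abs_gridCenter_sub_gridVertex_le X Y hf x1 y0)
  have d4 := abs_le.1 (abs_gridCenter_sub_gridVertex_le X Y hf x1 y1)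
  unfold muW
  rw [abs_le]
  constructor <;> linarith

/-- A spline whose coefficient functionals differ from the values at the centres by at most
`K` times the modulus of continuity approximates within `6 + K` times that modulus. -/
theorem abs_sub_spline_le (hf : ContinuousOn f (rectangle a b c d)) (μ : ℤ → ℤ → ℝ) {K : ℝ}
    (hμ : ∀ i j, |f (gridCenter X Y i j) - μ i j|
      ≤ K * modulusOn (rectangle a b c d) f (meshSize X Y / 2)) (hp : p ∈ rectangle a b c d) :
    |f p - ∑ i ∈ Finset.Icc (0 : ℤ) (X.size + 1), ∑ j ∈ Finset.Icc (0 : ℤ) (Y.size + 1),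
        μ i j * crissCrossBSpline X Y i j p|
      ≤ (6 + K) * modulusOn (rectangle a b c d) f (meshSize X Y / 2) := by
  refine abs_sub_sum_mul_le_of_partition_of_unity _ _ _ _ _ _
    (crissCrossBSpline_nonneg X Y hp) (sum_crissCrossBSpline X Y hp) fun i j hij => ?_
  have h1 := abs_sub_gridCenter_le X Y hf hp hij
  linarith [hμ i j, abs_sub_le (f p) (f (gridCenter X Y i j)) (μ i j)]

end CrissCross

theorem theorem1 :
    (∃ C₀ : ℝ, 0 < C₀ ∧ C₀ ≤ 20.5 ∧
      ∀ (a b c d : ℝ) (X : KnotPartition a b) (Y : KnotPartition c d)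
        (f : EuclideanSpace ℝ (Fin 2) → ℝ), ContinuousOn f (rectangle a b c d) →
        BddAbove (absValuesOn (rectangle a b c d) (f - quasiS X Y f)) ∧
        supNormOn (rectangle a b c d) (f - quasiS X Y f)
          ≤ C₀ * modulusOn (rectangle a b c d) f (meshSize X Y / 2)) ∧
    (∃ C₀ : ℝ, 0 < C₀ ∧ C₀ ≤ 12 ∧
      ∀ (a b c d : ℝ) (X : KnotPartition a b) (Y : KnotPartition c d)
        (f : EuclideanSpace ℝ (Fin 2) → ℝ), ContinuousOn f (rectangle a b c d) →
        BddAbove (absValuesOn (rectangle a b c d) (f - quasiW X Y f)) ∧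
        supNormOn (rectangle a b c d) (f - quasiW X Y f)
          ≤ C₀ * modulusOn (rectangle a b c d) f (meshSize X Y / 2)) := by
  refine ⟨⟨6 + 4, by norm_num, by norm_num, fun a b c d X Y f hf => ?_⟩,
    ⟨6 + 2, by norm_num, by norm_num, fun a b c d X Y f hf => ?_⟩⟩
  · exact bddAbove_and_supNormOn_le (mul_nonneg (by norm_num) (modulusOn_nonneg _))
      fun p hp => abs_sub_spline_le X Y hf _ (abs_gridCenter_sub_muS_le X Y hf) hp
  · exact bddAbove_and_supNormOn_le (mul_nonneg (by norm_num) (modulusOn_nonneg _))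
      fun p hp => abs_sub_spline_le X Y hf _ (abs_gridCenter_sub_muW_le X Y hf) hp
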